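/- For every $k\in\mathbb N$ consider a Gaussian heteroscedastic split-plot design: numbers $a=a_k,\ d=d_k,\ n_i=n_{k,i}\in\mathbb N$ ($i=1,\dots,a$), independent random vectors $X_{i,j}\sim\mathcal N_d(\mu_i,\Sigma_i)$ ($j=1,\dots,n_i$, $i=1,\dots,a$) with mean vectors $\mu_i\in\mathbb R^d$ and positive definite covariance matrices $\Sigma_i\in\mathbb R^{d\times d}$, and a matrix $T=T_W\otimes T_S\neq 0$, where $T_W\in\mathbb R^{a\times a}$ and $T_S\in\mathbb R^{d\times d}$ are symmetric and idempotent; all of these may depend on $k$. Let $N=\sum_{i=1}^a n_i$, $\mu=(\mu_1^\top,\dots,\mu_a^\top)^\top$, $\overline X_i=n_i^{-1}\sum_{j=1}^{n_i}X_{i,j}$, $\overline X=(\overline X_1^\top,\dots,\overline X_a^\top)^\top$, and $$V_N=\bigoplus_{i=1}^a\frac N{n_i}\Sigma_i,\qquad Q_N=N\,\overline X^\top T\,\overline X,\qquad \widetilde W_N=\frac{Q_N-\mathbb E(Q_N)}{\operatorname{Var}(Q_N)^{1/2}} .$$ Let $\lambda_1\ge\lambda_2\ge\dots\ge\lambda_{ad}$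 be the eigenvalues of $TV_NT$, counted with multiplicity, and let $\beta_s=\lambda_s\big/\sqrt{\sum_{\ell=1}^{ad}\lambda_\ell^2}$ for $s\le ad$ and $\beta_s=0$ for $s>ad$. Assume that the null hypothesis $H_0(T):T\mu=0$ holds for every $k$ and that, as $k\to\infty$, one of the following holds: $a$ is fixed and $\min(d,n_1,\dots,n_a)\to\infty$; or $d$ is fixed and $\min(a,n_1,\dots,n_a)\to\infty$; or $\min(a,d,n_1,\dots,n_a)\to\infty$. Then, as $k\to\infty$: (a) if $\beta_1\to0$, then $\widetilde W_N$ converges in distribution to the standard normal distribution; (b) if $\beta_1\to1$, then $\widetilde W_N$ converges in distribution to $(C-1)/\sqrt2$, where $C\sim\chi^2_1$; (c) if $\beta_s\to b_s$ for every $s\in\mathbb N$, where $(b_s)_{s\ge1}$ is a decreasing (not necessarily strictly) sequence in $[0,1]$ with $\sum_{s=1}^\infty b_s^2=1$, then, for every sequence $(C_s)_{s\ge1}$ of independent $\chi^2_1$-distributed random variables, the series $\sum_{s=1}^\infty b_s\,(C_s-1)/\sqrt2$ converges almost surely and $\widetilde W_N$ converges in distribution to its sum. -/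

import Mathlib

open MeasureTheory ProbabilityTheory Filter
open scoped Topology Kronecker Matrix

noncomputable section

/-- The deterministic part of a heteroscedastic split-plot design with `a` groups of
`d`-dimensional observation vectors: the group sizes `n i`, the mean vectors `μ i`, the positive
definite covariance matrices `S i`, and the whole-plot and subplot projection matrices
`TW` and `TS` (symmetric and idempotent). -/
structure SplitPlotDesign where
  a : ℕ
  d : ℕ
  n : Fin a → ℕ
  n_pos : ∀ i, 0 < n i
  μ : Fin a → EuclideanSpace ℝ (Fin d)
  S : Fin a → Matrix (Fin d) (Fin d) ℝ
  S_posDef : ∀ i, (S i).PosDef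
  TW : Matrix (Fin a) (Fin a) ℝ
  TS : Matrix (Fin d) (Fin d) ℝ
  TW_symm : TW.IsSymm
  TW_idem : IsIdempotentElem TW
  TS_symm : TS.IsSymm
  TS_idem : IsIdempotentElem TS

namespace SplitPlotDesign

variable (D : SplitPlotDesign)

/-- The total sample size `N = n₁ + ⋯ + nₐ`. -/
def N : ℕ := ∑ i, D.n i

/-- The projection matrix `T = T_W ⊗ T_S`. A vector in `ℝ^{ad}` is indexed by the pairs
`(i, t)`, group `i` and coordinate `t`. -/
def T : Matrix (Fin D.a × Fin D.d) (Fin D.a × Fin D.d) ℝ := D.TW ⊗ₖ D.TS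

/-- The block diagonal matrix `V_N = ⨁ᵢ (N / nᵢ) Σᵢ`. -/
def V : Matrix (Fin D.a × Fin D.d) (Fin D.a × Fin D.d) ℝ :=
  Matrix.of fun p q => if p.1 = q.1 then ((D.N : ℝ) / (D.n p.1 : ℝ)) * D.S p.1 p.2 q.2 else 0

/-- The stacked mean vector `(μ₁ᵀ, …, μₐᵀ)ᵀ`. -/
def stackedMean : Fin D.a × Fin D.d → ℝ := fun p => D.μ p.1 p.2

/-- The null hypothesis `H₀(T) : T μ = 0`. -/
def NullHypothesis : Prop := D.T *ᵥ D.stackedMean = 0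

theorem T_isHermitian : D.T.IsHermitian := by
  ext p q
  simp only [Matrix.conjTranspose_apply, star_trivial, T, Matrix.kroneckerMap_apply]
  rw [D.TW_symm.apply, D.TS_symm.apply]

theorem V_isHermitian : D.V.IsHermitian := by
  ext p q
  simp only [Matrix.conjTranspose_apply, star_trivial, V, Matrix.of_apply]
  by_cases h : p.1 = q.1
  · have hs := (D.S_posDef q.1).isHermitian.apply p.2 q.2
    rw [star_trivial] at hs
    simp [h, hs]
  · simp [h, Ne.symm h]

theorem TVT_isHermitian : (D.T * D.V * D.T).IsHermitian := by
  have h := Matrix.isHermitian_mul_mul_conjTranspose D.T D.V_isHermitian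
  rwa [D.T_isHermitian.eq] at h

/-- The `ad` eigenvalues of `T V_N T`, with multiplicity and in decreasing order. -/
def eigval : Fin (Fintype.card (Fin D.a × Fin D.d)) → ℝ := D.TVT_isHermitian.eigenvalues₀

/-- The normalized eigenvalues `β_s = λ_s / (∑_ℓ λ_ℓ²)^{1/2}`, counted from `s = 0` (so
`β 0` is the largest one), and `0` beyond the last index. -/
def β (s : ℕ) : ℝ :=
  if h : s < Fintype.card (Fin D.a × Fin D.d) then
    D.eigval ⟨s, h⟩ / √(∑ l, D.eigval l ^ 2)
  else 0

variable {Ω : Type*} [MeasurableSpace Ω]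

/-- The observations `X i j`, with `j < n i`, are independent and `X i j ∼ N_d(μ i, S i)`. -/
structure IsGaussianSample (P : Measure Ω)
    (X : (i : Fin D.a) → Fin (D.n i) → Ω → EuclideanSpace ℝ (Fin D.d)) : Prop where
  law : ∀ i j, HasLaw (X i j) (multivariateGaussian (D.μ i) (D.S i)) P
  indep : iIndepFun (fun p : (i : Fin D.a) × Fin (D.n i) => X p.1 p.2) P

/-- The stacked vector of the group means `n_i⁻¹ ∑_j X_{i,j}`. -/
def groupMeans (X : (i : Fin D.a) → Fin (D.n i) → Ω → EuclideanSpace ℝ (Fin D.d)) (ω : Ω) :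
    Fin D.a × Fin D.d → ℝ :=
  fun p => (D.n p.1 : ℝ)⁻¹ * ∑ j, X p.1 j ω p.2

/-- The quadratic form `Q_N = N · X̄ᵀ T X̄`. -/
def Q (X : (i : Fin D.a) → Fin (D.n i) → Ω → EuclideanSpace ℝ (Fin D.d)) (ω : Ω) : ℝ :=
  (D.N : ℝ) * (D.groupMeans X ω ⬝ᵥ D.T *ᵥ D.groupMeans X ω)

/-- The standardized quadratic form `(Q_N - E(Q_N)) / Var(Q_N)^{1/2}`. -/
def W (P : Measure Ω)
    (X : (i : Fin D.a) → Fin (D.n i) → Ω → EuclideanSpace ℝ (Fin D.d)) (ω : Ω) : ℝ :=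
  (D.Q X ω - ∫ ω', D.Q X ω' ∂P) / √(variance (D.Q X) P)

end SplitPlotDesign

/-- `min (n₁, …, nₐ) → ∞` along a sequence of designs. -/
def MinSampleSizeDiverges (D : ℕ → SplitPlotDesign) : Prop :=
  ∀ m : ℕ, ∀ᶠ k in atTop, ∀ i, m ≤ (D k).n i

/-- The three asymptotic frameworks: `a` fixed and `min (d, n₁, …, nₐ) → ∞`; or `d` fixed and
`min (a, n₁, …, nₐ) → ∞`; or `min (a, d, n₁, …, nₐ) → ∞`. -/
def AsymptoticFramework (D : ℕ → SplitPlotDesign) : Prop :=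
  ((∃ a₀, ∀ k, (D k).a = a₀) ∧ Tendsto (fun k => (D k).d) atTop atTop ∧
      MinSampleSizeDiverges D) ∨
  ((∃ d₀, ∀ k, (D k).d = d₀) ∧ Tendsto (fun k => (D k).a) atTop atTop ∧
      MinSampleSizeDiverges D) ∨
  (Tendsto (fun k => (D k).a) atTop atTop ∧ Tendsto (fun k => (D k).d) atTop atTop ∧
      MinSampleSizeDiverges D)

/-- The `χ²₁` distribution: the law of the square of a standard normal random variable. -/
def chiSqOne : Measure ℝ := (gaussianReal 0 1).map (fun x => x ^ 2)

instance : IsProbabilityMeasure chiSqOne :=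
  Measure.isProbabilityMeasure_map (by fun_prop)

end

/-!
# Limit laws of the standardized quadratic form in high-dimensional split-plot designs

Under the null hypothesis `T μ = 0` the statistic `Q_N` is the quadratic form `Yᵀ T Y` in the
Gaussian vector `Y = √N • X̄`, whose covariance matrix is `V_N`. In an orthonormal eigenbasis of
`T V_N T` the coordinates of `T Y` are independent centered normal variables with variances `λₛ`, so
`Q_N` has the law of `∑ₛ λₛ Cₛ` with independent `χ²₁` variables `Cₛ`
(`identDistrib_gaussian_quadraticForm`). A `χ²₁` variable has mean `1` and variance `2`; hence the
standardized form has, for each design, the law of `∑ₛ βₛ ξₛ` with the standardized variables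
`ξₛ = (Cₛ - 1) / √2` and `∑ₛ βₛ² = 1` (`SplitPlotDesign.IsGaussianSample.identDistrib_W`). Only this
law matters for convergence in distribution, so a single i.i.d. sequence `(Cₛ)` serves all designs.

* If `β₁ → 0`, the Taylor expansion of the characteristic function of `ξₛ` gives a central limit
  theorem for weighted sums (`tendstoInDistribution_weightedSum_gaussianReal`).
* If `βₛ → bₛ` for all `s` and `∑ₛ bₛ² = 1`, then `β → b` in `ℓ²` by Scheffé's lemma
  (`tendsto_tsum_sq_sub_of_tendsto`), and the isometry `c ↦ ∑ₛ cₛ ξₛ` from `ℓ²` to `L²` turns this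
  into convergence in `L²` (`tendstoInDistribution_weightedSum`). The limit series converges almost
  surely by the martingale convergence theorem.
* If `β₁ → 1`, then `βₛ → 0` for every `s ≥ 2`, which is the previous case with `b = (1, 0, 0, …)`.
-/

/-! ### Moments of the `χ²₁` distribution -/

/-- The fourth moment of the standard normal distribution, from the derivatives of its
moment generating function `exp (t² / 2)`. -/
theorem integral_pow_four_gaussianReal : ∫ x, x ^ 4 ∂(gaussianReal 0 1) = 3 := by
  set m : ℕ → ℝ → ℝ := fun n t ↦ ∫ x, x ^ n * Real.exp (t * x) ∂(gaussianReal 0 1)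
  have hder (n : ℕ) (t : ℝ) : HasDerivAt (m n) (m (n + 1) t) t :=
    hasDerivAt_integral_pow_mul_exp_real (X := fun x ↦ x) (by simp) n
  have step (n : ℕ) (p p' : ℝ → ℝ) (hp : ∀ t, HasDerivAt p (p' t) t)
      (h : ∀ t, m n t = p t * Real.exp (t ^ 2 / 2)) (t : ℝ) :
      m (n + 1) t = (p' t + p t * t) * Real.exp (t ^ 2 / 2) := by
    have h1 := hder n t
    rw [funext h] at h1
    have h2 : HasDerivAt (fun s : ℝ ↦ Real.exp (s ^ 2 / 2)) (Real.exp (t ^ 2 / 2) * t) t := by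
      have h3 : HasDerivAt (fun s : ℝ ↦ s ^ 2 / 2) t t := by
        simpa using (hasDerivAt_pow 2 t).div_const 2
      exact h3.exp
    rw [h1.unique ((hp t).mul h2)]
    ring
  have m0 (t : ℝ) : m 0 t = 1 * Real.exp (t ^ 2 / 2) := by
    have := congrFun (mgf_fun_id_gaussianReal (μ := 0) (v := 1)) t
    simpa [m, mgf] using this
  have m1 (t : ℝ) : m 1 t = t * Real.exp (t ^ 2 / 2) := by
    rw [step 0 (fun _ ↦ 1) (fun _ ↦ 0) (fun t ↦ hasDerivAt_const t 1) m0]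
    simp
  have m2 (t : ℝ) : m 2 t = (1 + t ^ 2) * Real.exp (t ^ 2 / 2) := by
    rw [step 1 (fun t ↦ t) (fun _ ↦ 1) hasDerivAt_id m1]
    ring
  have m3 (t : ℝ) : m 3 t = (3 * t + t ^ 3) * Real.exp (t ^ 2 / 2) := by
    rw [step 2 (fun t ↦ 1 + t ^ 2) (fun t ↦ 2 * t)
      (fun t ↦ by simpa using (hasDerivAt_pow 2 t).const_add 1) m2]
    ring
  have m4 := step 3 (fun t ↦ 3 * t + t ^ 3) (fun t ↦ 3 + 3 * t ^ 2)
    (fun t ↦ by simpa using ((hasDerivAt_id t).const_mul 3).fun_add (hasDerivAt_pow 3 t)) m3 0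
  simpa [m] using m4

theorem memLp_two_id_chiSqOne : MemLp id 2 chiSqOne := by
  rw [chiSqOne, memLp_map_measure_iff aestronglyMeasurable_id (by fun_prop), Function.id_comp,
    memLp_two_iff_integrable_sq (by fun_prop)]
  have h : MemLp id ((4 : ℕ) : ENNReal) (gaussianReal 0 1) := memLp_id_gaussianReal' _ (by simp)
  have h' := h.integrable_norm_pow (by norm_num)
  refine h'.congr (ae_of_all _ fun x ↦ ?_)
  simp only [id_eq, Real.norm_eq_abs, ← pow_mul]
  exact Even.pow_abs ⟨2, rfl⟩ x

theorem integral_id_chiSqOne : ∫ x, x ∂chiSqOne = 1 := by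
  rw [chiSqOne, integral_map (by fun_prop) (by fun_prop)]
  have h := variance_fun_id_gaussianReal (μ := 0) (v := 1)
  rw [variance_eq_integral (by fun_prop)] at h
  simpa using h

theorem variance_id_chiSqOne : Var[id; chiSqOne] = 2 := by
  rw [variance_eq_sub memLp_two_id_chiSqOne]
  simp only [id_eq, integral_id_chiSqOne, Pi.pow_apply]
  rw [chiSqOne, integral_map (by fun_prop) (by fun_prop)]
  simp only [← pow_mul]
  norm_num [integral_pow_four_gaussianReal]

/-! ### Gaussian quadratic forms -/

/-- The law of a quadratic form `Yᵀ T Y` in a Gaussian vector `Y`, for a symmetric idempotent matrix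
`T` that annihilates the mean: it is that of `∑ᵢ λᵢ Cᵢ` with `Cᵢ` independent `χ²₁` variables and
`λᵢ` the eigenvalues of `T K T`, where `K` is the covariance matrix of `Y`. In an orthonormal
eigenbasis of `T K T` the coordinates of `T Y` are uncorrelated, hence independent, and the
`i`-th one is normal with mean `0` and variance `λᵢ`. -/
theorem identDistrib_gaussian_quadraticForm {ι Ω Ω' : Type*} [Fintype ι] [DecidableEq ι]
    [MeasurableSpace Ω] [MeasurableSpace Ω'] {P : Measure Ω} {P' : Measure Ω'}
    {Y : ι → Ω → ℝ} (hY : HasGaussianLaw (fun ω p ↦ Y p ω) P)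
    {T K : Matrix ι ι ℝ} (hTs : T.IsSymm) (hTi : IsIdempotentElem T)
    (hmean : T *ᵥ (fun p ↦ ∫ ω, Y p ω ∂P) = 0)
    (hcov : ∀ p q, cov[Y p, Y q; P] = K p q) (hM : (T * K * T).IsHermitian)
    (C : ι → Ω' → ℝ) (hC : ∀ i, HasLaw (C i) chiSqOne P') (hind : iIndepFun C P') :
    IdentDistrib (fun ω ↦ (fun p ↦ Y p ω) ⬝ᵥ T *ᵥ (fun p ↦ Y p ω))
      (fun ω ↦ ∑ i, hM.eigenvalues i * C i ω) P P' := by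
  have := hY.isProbabilityMeasure
  have := hind.isProbabilityMeasure
  set U : Matrix ι ι ℝ := ↑hM.eigenvectorUnitary
  have hUU : U * Uᵀ = 1 := Unitary.coe_mul_star_self hM.eigenvectorUnitary
  set A : Matrix ι ι ℝ := Uᵀ * T with hA
  have hTt : Tᵀ = T := hTs
  have hAA : Aᵀ * A = T := by
    rw [hA, Matrix.transpose_mul, Matrix.transpose_transpose, hTt, Matrix.mul_assoc,
      ← Matrix.mul_assoc U, hUU, Matrix.one_mul, hTi.eq]
  have hAK : A * K * Aᵀ = Matrix.diagonal hM.eigenvalues := by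
    have h := hM.conjStarAlgAut_star_eigenvectorUnitary
    rw [Unitary.conjStarAlgAut_apply] at h
    rw [hA, Matrix.transpose_mul, Matrix.transpose_transpose, hTt]
    simpa [Matrix.mul_assoc, U, Matrix.star_eq_conjTranspose, Function.comp_def] using h
  set Z : ι → Ω → ℝ := fun i ω ↦ ∑ p, A i p * Y p ω with hZ
  have hYi (p : ι) : HasGaussianLaw (Y p) P := hY.eval p
  have hZg : HasGaussianLaw (fun ω i ↦ Z i ω) P :=
    hY.map_fun (LinearMap.toContinuousLinearMap (Matrix.mulVecLin A))
  have hZcov (i j : ι) : cov[Z i, Z j; P] = Matrix.diagonal hM.eigenvalues i j := by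
    rw [hZ, covariance_fun_sum_fun_sum (fun p ↦ (hYi p).memLp_two.const_mul _)
      (fun p ↦ (hYi p).memLp_two.const_mul _), ← hAK]
    simp only [covariance_const_mul_left, covariance_const_mul_right, hcov, Matrix.mul_apply,
      Matrix.transpose_apply, Finset.sum_mul]
    rw [Finset.sum_comm]
    exact Finset.sum_congr rfl fun _ _ ↦ Finset.sum_congr rfl fun _ _ ↦ by ring
  have hZmean (i : ι) : ∫ ω, Z i ω ∂P = 0 := by
    have h : A *ᵥ (fun p ↦ ∫ ω, Y p ω ∂P) = 0 := by
      rw [hA, ← Matrix.mulVec_mulVec, hmean, Matrix.mulVec_zero]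
    rw [hZ, integral_finsetSum _ fun p _ ↦ (hYi p).integrable.const_mul _]
    simpa [integral_const_mul, Matrix.mulVec, dotProduct] using congrFun h i
  have hZind : iIndepFun Z P := hZg.iIndepFun_of_covariance_eq_zero fun i j hij ↦ by
    rw [hZcov, Matrix.diagonal_apply_ne _ hij]
  have hlam (i : ι) : 0 ≤ hM.eigenvalues i := by
    rw [← Matrix.diagonal_apply_eq hM.eigenvalues i, ← hZcov,
      covariance_self (hZg.eval i).aemeasurable]
    exact variance_nonneg _ _
  have hZlaw (i : ι) : HasLaw (fun ω ↦ Z i ω ^ 2) (chiSqOne.map (hM.eigenvalues i * ·)) P := by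
    refine ⟨(hZg.eval i).aemeasurable.pow_const 2, ?_⟩
    have h1 : P.map (Z i) = (gaussianReal 0 1).map (√(hM.eigenvalues i) * ·) := by
      rw [(hZg.eval i).map_eq_gaussianReal, gaussianReal_map_const_mul, hZmean,
        ← covariance_self (hZg.eval i).aemeasurable, hZcov, Matrix.diagonal_apply_eq, mul_zero]
      congr 1
      ext
      simp [hlam i]
    have h2 : P.map (fun ω ↦ Z i ω ^ 2) = (P.map (Z i)).map (fun x ↦ x ^ 2) :=
      (AEMeasurable.map_map_of_aemeasurable (g := fun x : ℝ ↦ x ^ 2) (by fun_prop)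
        (hZg.eval i).aemeasurable).symm
    rw [h2, h1, chiSqOne, Measure.map_map (by fun_prop) (by fun_prop),
      Measure.map_map (by fun_prop) (by fun_prop)]
    congr 1
    ext x
    simp [mul_pow, Real.sq_sqrt (hlam i)]
  have hClaw (i : ι) : HasLaw (fun ω ↦ hM.eigenvalues i * C i ω)
      (chiSqOne.map (hM.eigenvalues i * ·)) P' :=
    HasLaw.fun_comp (Y := fun x ↦ hM.eigenvalues i * x) ⟨by fun_prop, rfl⟩ (hC i)
  have hpi := IdentDistrib.pi (fun i ↦ (hZlaw i).identDistrib (hClaw i))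
    (hZind.comp (fun _ x ↦ x ^ 2) (by fun_prop))
    (hind.comp (fun i x ↦ hM.eigenvalues i * x) (by fun_prop))
  have hQ (ω : Ω) : (fun p ↦ Y p ω) ⬝ᵥ T *ᵥ (fun p ↦ Y p ω) = ∑ i, Z i ω ^ 2 := by
    have hZA : (fun i ↦ Z i ω) = A *ᵥ (fun p ↦ Y p ω) := rfl
    calc (fun p ↦ Y p ω) ⬝ᵥ T *ᵥ (fun p ↦ Y p ω)
        = (fun i ↦ Z i ω) ⬝ᵥ (fun i ↦ Z i ω) := by
          rw [hZA, ← hAA, ← Matrix.mulVec_mulVec, Matrix.dotProduct_mulVec,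
            Matrix.vecMul_transpose]
      _ = ∑ i, Z i ω ^ 2 := by simp [dotProduct, sq]
  simp_rw [hQ]
  exact hpi.comp (u := fun x ↦ ∑ i, x i) (by fun_prop)

/-! ### The quadratic form of a split-plot design -/

namespace SplitPlotDesign

variable {D : SplitPlotDesign} {Ω : Type*} [MeasurableSpace Ω] {P : Measure Ω}
  {X : (i : Fin D.a) → Fin (D.n i) → Ω → EuclideanSpace ℝ (Fin D.d)}

theorem IsGaussianSample.hasGaussianLaw_groupMeans (hX : D.IsGaussianSample P X) :
    HasGaussianLaw (fun ω p ↦ D.groupMeans X ω p) P := by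
  have h : HasGaussianLaw (fun ω (q : (i : Fin D.a) × Fin (D.n i)) ↦ X q.1 q.2 ω) P :=
    hX.indep.hasGaussianLaw fun q ↦ (hX.law q.1 q.2).hasGaussianLaw
  let L : ((_ : (i : Fin D.a) × Fin (D.n i)) → EuclideanSpace ℝ (Fin D.d)) →L[ℝ]
      (Fin D.a × Fin D.d → ℝ) := ContinuousLinearMap.pi fun p ↦ (D.n p.1 : ℝ)⁻¹ •
    ∑ j : Fin (D.n p.1), (EuclideanSpace.proj (𝕜 := ℝ) p.2).comp
      (ContinuousLinearMap.proj ⟨p.1, j⟩)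
  have hL : (fun ω p ↦ D.groupMeans X ω p) = fun ω ↦ L (fun q ↦ X q.1 q.2 ω) := by
    ext ω p
    simp [L, groupMeans]
  rw [hL]
  exact h.map_fun L

theorem IsGaussianSample.memLp_apply (hX : D.IsGaussianSample P X) (i : Fin D.a)
    (j : Fin (D.n i)) (t : Fin D.d) : MemLp (fun ω ↦ X i j ω t) 2 P :=
  ((hX.law i j).hasGaussianLaw.map_fun (EuclideanSpace.proj (𝕜 := ℝ) t)).memLp_two

theorem IsGaussianSample.integral_groupMeans [IsProbabilityMeasure P]
    (hX : D.IsGaussianSample P X) (p : Fin D.a × Fin D.d) :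
    ∫ ω, D.groupMeans X ω p ∂P = D.stackedMean p := by
  have hn : (D.n p.1 : ℝ) ≠ 0 := by exact_mod_cast (D.n_pos p.1).ne'
  have h (j : Fin (D.n p.1)) : ∫ ω, X p.1 j ω p.2 ∂P = D.μ p.1 p.2 := by
    have h1 := (EuclideanSpace.proj (𝕜 := ℝ) p.2).integral_comp_comm
      (hX.law p.1 j).hasGaussianLaw.integrable
    rw [(hX.law p.1 j).integral_eq, integral_id_multivariateGaussian] at h1
    exact h1
  simp only [groupMeans]
  rw [integral_const_mul, integral_finsetSum _ fun j _ ↦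
    (hX.memLp_apply p.1 j p.2).integrable (by norm_num)]
  simp [h, stackedMean, hn]

theorem IsGaussianSample.covariance_groupMeans [IsProbabilityMeasure P]
    (hX : D.IsGaussianSample P X) (p q : Fin D.a × Fin D.d) :
    cov[fun ω ↦ D.groupMeans X ω p, fun ω ↦ D.groupMeans X ω q; P] =
      if p.1 = q.1 then (D.n p.1 : ℝ)⁻¹ * D.S p.1 p.2 q.2 else 0 := by
  simp only [groupMeans]
  rw [covariance_const_mul_left, covariance_const_mul_right,
    covariance_fun_sum_fun_sum (fun j ↦ hX.memLp_apply p.1 j p.2)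
      (fun j ↦ hX.memLp_apply q.1 j q.2)]
  have hzero (i i' : Fin D.a) (j : Fin (D.n i)) (j' : Fin (D.n i')) (t t' : Fin D.d)
      (hne : (⟨i, j⟩ : (i : Fin D.a) × Fin (D.n i)) ≠ ⟨i', j'⟩) :
      cov[fun ω ↦ X i j ω t, fun ω ↦ X i' j' ω t'; P] = 0 := by
    have h := (hX.indep.indepFun hne).comp (φ := fun x : EuclideanSpace ℝ (Fin D.d) ↦ x t)
      (ψ := fun x : EuclideanSpace ℝ (Fin D.d) ↦ x t') (by fun_prop) (by fun_prop)
    exact h.covariance_eq_zero (hX.memLp_apply i j t) (hX.memLp_apply i' j' t')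
  obtain ⟨i, t⟩ := p
  obtain ⟨i', t'⟩ := q
  by_cases hii : i = i'
  · subst hii
    have hn : (D.n i : ℝ) ≠ 0 := by exact_mod_cast (D.n_pos i).ne'
    have hsum (j : Fin (D.n i)) :
        ∑ j', cov[fun ω ↦ X i j ω t, fun ω ↦ X i j' ω t'; P] = D.S i t t' := by
      rw [Finset.sum_eq_single_of_mem j (Finset.mem_univ j) fun j' _ hj' ↦
        hzero i i j j' t t' fun h ↦ hj' (by simpa using h.symm)]
      rw [(hX.law i j).covariance_fun_comp (f := fun x ↦ x t) (g := fun x ↦ x t')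
        (by fun_prop) (by fun_prop)]
      exact covariance_eval_multivariateGaussian (D.S_posDef i).posSemidef t t'
    simp only [hsum]
    simp only [Finset.sum_const, Finset.card_univ, Fintype.card_fin, nsmul_eq_mul, if_true]
    field_simp
  · simp only [hii, if_false]
    rw [Finset.sum_eq_zero fun j _ ↦ Finset.sum_eq_zero fun j' _ ↦
      hzero i i' j j' t t' fun h ↦ hii (congrArg Sigma.fst h)]
    simp

variable (D) in
theorem T_isSymm : D.T.IsSymm := by
  have h := D.T_isHermitian.eq
  rwa [Matrix.conjTranspose_eq_transpose_of_trivial] at h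

variable (D) in
theorem T_isIdempotentElem : IsIdempotentElem D.T := by
  rw [IsIdempotentElem, T, ← Matrix.mul_kronecker_mul, D.TW_idem.eq, D.TS_idem.eq]

/-- Under the null hypothesis `Q_N` has the law of `∑ₛ λₛ Cₛ`, where the `λₛ` are the eigenvalues
of `T V_N T` and the `Cₛ` are independent `χ²₁` variables. -/
theorem IsGaussianSample.identDistrib_Q [IsProbabilityMeasure P]
    (hX : D.IsGaussianSample P X) (hnull : D.NullHypothesis)
    {Ω' : Type*} [MeasurableSpace Ω'] {P' : Measure Ω'} {C : ℕ → Ω' → ℝ}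
    (hC : ∀ s, HasLaw (C s) chiSqOne P') (hind : iIndepFun C P') :
    IdentDistrib (D.Q X) (fun ω ↦ ∑ l, D.eigval l * C l ω) P P' := by
  set e : Fin (Fintype.card (Fin D.a × Fin D.d)) ≃ Fin D.a × Fin D.d :=
    Fintype.equivOfCardEq (Fintype.card_fin _) with he
  have hY : HasGaussianLaw (fun ω p ↦ √(D.N : ℝ) * D.groupMeans X ω p) P :=
    hX.hasGaussianLaw_groupMeans.fun_smul (√(D.N : ℝ))
  have h := identDistrib_gaussian_quadraticForm (Y := fun p ω ↦ √(D.N : ℝ) * D.groupMeans X ω p)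
    hY D.T_isSymm D.T_isIdempotentElem (K := D.V) ?_ ?_ D.TVT_isHermitian
    (fun p ↦ C (e.symm p)) (fun p ↦ hC _)
    (hind.precomp (g := fun p ↦ (e.symm p : ℕ))
      (Fin.val_injective.comp e.symm.injective))
  · convert! h using 2 with ω ω
    · have hY' : (fun p ↦ √(D.N : ℝ) * D.groupMeans X ω p) = √(D.N : ℝ) • D.groupMeans X ω := rfl
      rw [hY', Matrix.mulVec_smul, smul_dotProduct, dotProduct_smul, smul_eq_mul, smul_eq_mul,
        ← mul_assoc, Real.mul_self_sqrt (Nat.cast_nonneg _), Q]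
    · rw [← e.sum_comp]
      simp [eigval, Matrix.IsHermitian.eigenvalues, he]
  · simp only [integral_const_mul, hX.integral_groupMeans]
    exact (Matrix.mulVec_smul D.T (√(D.N : ℝ)) D.stackedMean).trans (by rw [hnull, smul_zero])
  · intro p q
    rw [covariance_const_mul_left, covariance_const_mul_right, hX.covariance_groupMeans,
      ← mul_assoc, Real.mul_self_sqrt (Nat.cast_nonneg _)]
    simp only [V, Matrix.of_apply, mul_ite, mul_zero, div_eq_mul_inv, mul_assoc]

/-- Under the null hypothesis the standardized quadratic form has the law of
`∑ₛ βₛ (Cₛ - 1) / √2`, where the `Cₛ` are independent `χ²₁` variables. -/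
theorem IsGaussianSample.identDistrib_W [IsProbabilityMeasure P]
    (hX : D.IsGaussianSample P X) (hnull : D.NullHypothesis)
    {Ω' : Type*} [MeasurableSpace Ω'] {P' : Measure Ω'} {C : ℕ → Ω' → ℝ}
    (hC : ∀ s, HasLaw (C s) chiSqOne P') (hind : iIndepFun C P') :
    IdentDistrib (D.W P X) (fun ω ↦ ∑ s ∈ Finset.range (Fintype.card (Fin D.a × Fin D.d)),
      D.β s * ((C s ω - 1) / √2)) P P' := by
  have := hind.isProbabilityMeasure
  have hQ := hX.identDistrib_Q hnull hC hind
  have hmem (s : ℕ) : MemLp (C s) 2 P' :=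
    ((hC s).identDistrib HasLaw.id).symm.memLp_snd memLp_two_id_chiSqOne
  have hint : ∫ ω, D.Q X ω ∂P = ∑ l, D.eigval l := by
    rw [hQ.integral_eq, integral_finsetSum _ fun (l : Fin _) _ ↦
      ((hmem l).integrable (by norm_num)).const_mul _]
    simp [integral_const_mul, (hC _).integral_eq, integral_id_chiSqOne]
  have hvar : Var[D.Q X; P] = 2 * ∑ l, D.eigval l ^ 2 := by
    have hsum : (fun ω ↦ ∑ l, D.eigval l * C l ω) = ∑ l, fun ω ↦ D.eigval l * C l ω := by
      ext ω
      simp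
    rw [hQ.variance_eq, hsum, IndepFun.variance_sum fun (l : Fin _) _ ↦ (hmem l).const_mul _]
    · simp only [variance_const_mul, (hC _).variance_eq, variance_id_chiSqOne]
      rw [Finset.mul_sum]
      exact Finset.sum_congr rfl fun l _ ↦ mul_comm _ _
    · intro l _ l' _ hll
      exact (hind.indepFun (Fin.val_injective.ne hll)).comp
        (φ := fun x ↦ D.eigval l * x) (ψ := fun x ↦ D.eigval l' * x) (by fun_prop) (by fun_prop)
  have h := hQ.comp (u := fun x ↦ (x - ∑ l, D.eigval l) / √(2 * ∑ l, D.eigval l ^ 2))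
    (by fun_prop)
  convert! h using 1
  · ext ω
    simp [W, hint, hvar]
  · ext ω
    rw [Finset.sum_range]
    simp only [Function.comp_apply, β, Fin.is_lt, dif_pos, Fin.eta]
    rw [← Finset.sum_sub_distrib, Finset.sum_div, Real.sqrt_mul (by norm_num)]
    exact Finset.sum_congr rfl fun l _ ↦ by ring

/-! ### The normalized eigenvalues -/

theorem dotProduct_V_mulVec_eq (x : Fin D.a × Fin D.d → ℝ) :
    x ⬝ᵥ D.V *ᵥ x = ∑ i, ((D.N : ℝ) / D.n i) *
      ((fun t ↦ x (i, t)) ⬝ᵥ D.S i *ᵥ (fun t ↦ x (i, t))) := by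
  simp only [dotProduct, Matrix.mulVec, Fintype.sum_prod_type, V, Matrix.of_apply]
  refine Finset.sum_congr rfl fun i _ ↦ ?_
  rw [Finset.mul_sum]
  refine Finset.sum_congr rfl fun t _ ↦ ?_
  rw [Finset.sum_eq_single_of_mem i (Finset.mem_univ i) fun i' _ hi' ↦
    Finset.sum_eq_zero fun t' _ ↦ by simp [hi'.symm]]
  simp only [if_true, Finset.mul_sum]
  exact Finset.sum_congr rfl fun t' _ ↦ by ring

theorem V_posDef : D.V.PosDef := by
  refine Matrix.PosDef.of_dotProduct_mulVec_pos D.V_isHermitian fun x hx ↦ ?_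
  obtain ⟨⟨i, t⟩, hit⟩ := Function.ne_iff.mp hx
  have hN : (0 : ℝ) < D.N := by
    have h : D.n i ≤ D.N := Finset.single_le_sum (fun _ _ ↦ Nat.zero_le _) (Finset.mem_univ i)
    exact_mod_cast (D.n_pos i).trans_le h
  have hn (i : Fin D.a) : (0 : ℝ) < D.n i := by exact_mod_cast D.n_pos i
  rw [star_trivial, dotProduct_V_mulVec_eq]
  refine Finset.sum_pos' (fun i _ ↦ mul_nonneg (div_pos hN (hn i)).le ?_)
    ⟨i, Finset.mem_univ i, mul_pos (div_pos hN (hn i)) ?_⟩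
  · simpa using (D.S_posDef i).posSemidef.dotProduct_mulVec_nonneg (fun t ↦ x (i, t))
  · simpa using (D.S_posDef i).dotProduct_mulVec_pos (x := fun t ↦ x (i, t))
      fun h ↦ hit (congrFun h t)

theorem TVT_posSemidef : (D.T * D.V * D.T).PosSemidef := by
  have h := (V_posDef (D := D)).posSemidef.mul_mul_conjTranspose_same D.T
  rwa [D.T_isHermitian.eq] at h

theorem TVT_ne_zero (hT : D.T ≠ 0) : D.T * D.V * D.T ≠ 0 := by
  intro h
  apply hT
  ext p q
  by_contra hpq
  have hx : D.T *ᵥ Pi.single q 1 ≠ 0 := fun h0 ↦ hpq (by simpa using congrFun h0 p)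
  have hpos := (V_posDef (D := D)).dotProduct_mulVec_pos hx
  have hTt : D.Tᵀ = D.T := D.T_isSymm
  have hz : (D.T *ᵥ Pi.single q 1) ⬝ᵥ D.V *ᵥ (D.T *ᵥ Pi.single q 1) = 0 := by
    have h1 : D.T *ᵥ Pi.single q 1 = Pi.single q 1 ᵥ* D.T := by
      rw [← Matrix.vecMul_transpose, hTt]
    nth_rewrite 1 [h1]
    rw [← Matrix.dotProduct_mulVec, Matrix.mulVec_mulVec, Matrix.mulVec_mulVec, h]
    simp
  rw [star_trivial, hz] at hpos
  exact hpos.false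

theorem eigval_nonneg (l : Fin (Fintype.card (Fin D.a × Fin D.d))) : 0 ≤ D.eigval l := by
  have h := (TVT_posSemidef (D := D)).eigenvalues_nonneg
    ((Fintype.equivOfCardEq (Fintype.card_fin _)) l)
  simpa [eigval, Matrix.IsHermitian.eigenvalues] using h

theorem sum_sq_eigval_pos (hT : D.T ≠ 0) : 0 < ∑ l, D.eigval l ^ 2 := by
  refine (Finset.sum_nonneg fun l _ ↦ sq_nonneg _).lt_of_ne' fun h ↦ TVT_ne_zero hT ?_
  rw [Finset.sum_eq_zero_iff_of_nonneg fun l _ ↦ sq_nonneg _] at h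
  rw [← D.TVT_isHermitian.eigenvalues_eq_zero_iff]
  ext p
  exact pow_eq_zero_iff two_ne_zero |>.mp (h _ (Finset.mem_univ _))

theorem β_nonneg (s : ℕ) : 0 ≤ D.β s := by
  unfold β
  split_ifs
  · exact div_nonneg (eigval_nonneg _) (Real.sqrt_nonneg _)
  · exact le_rfl

theorem β_eq_zero_of_card_le {s : ℕ} (hs : Fintype.card (Fin D.a × Fin D.d) ≤ s) : D.β s = 0 :=
  dif_neg hs.not_gt

theorem β_le_β_zero (s : ℕ) : D.β s ≤ D.β 0 := by
  by_cases h : s < Fintype.card (Fin D.a × Fin D.d)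
  · have h0 := (Nat.zero_le s).trans_lt h
    simp only [β, h, h0, dif_pos]
    gcongr
    exact D.TVT_isHermitian.eigenvalues₀_antitone (Fin.mk_le_mk.mpr (Nat.zero_le s))
  · rw [β_eq_zero_of_card_le (not_lt.mp h)]
    exact β_nonneg 0

theorem sum_sq_β (hT : D.T ≠ 0) :
    ∑ s ∈ Finset.range (Fintype.card (Fin D.a × Fin D.d)), D.β s ^ 2 = 1 := by
  have h := sum_sq_eigval_pos hT
  rw [Finset.sum_range]
  simp only [β, Fin.is_lt, dif_pos, Fin.eta, div_pow, Real.sq_sqrt h.le]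
  rw [← Finset.sum_div, div_self h.ne']

end SplitPlotDesign

/-! ### Weighted sums of independent standardized variables -/

theorem norm_prod_sub_prod_le_sum {ι : Type*} (s : Finset ι) (f g : ι → ℂ)
    (hf : ∀ i ∈ s, ‖f i‖ ≤ 1) (hg : ∀ i ∈ s, ‖g i‖ ≤ 1) :
    ‖∏ i ∈ s, f i - ∏ i ∈ s, g i‖ ≤ ∑ i ∈ s, ‖f i - g i‖ := by
  classical
  induction s using Finset.induction_on with
  | empty => simp
  | insert a s ha ih =>
    rw [Finset.prod_insert ha, Finset.prod_insert ha, Finset.sum_insert ha]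
    have hg1 : ‖∏ i ∈ s, g i‖ ≤ 1 := by
      rw [norm_prod]
      exact Finset.prod_le_one (fun _ _ ↦ norm_nonneg _)
        fun i hi ↦ hg i (Finset.mem_insert_of_mem hi)
    have hih := ih (fun i hi ↦ hf i (Finset.mem_insert_of_mem hi))
      (fun i hi ↦ hg i (Finset.mem_insert_of_mem hi))
    have ha1 := hf a (Finset.mem_insert_self a s)
    calc ‖f a * ∏ i ∈ s, f i - g a * ∏ i ∈ s, g i‖
        = ‖(f a - g a) * ∏ i ∈ s, g i + f a * (∏ i ∈ s, f i - ∏ i ∈ s, g i)‖ := by ring_nf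
      _ ≤ ‖f a - g a‖ * 1 + 1 * ∑ i ∈ s, ‖f i - g i‖ := by
        refine (norm_add_le _ _).trans ?_
        rw [norm_mul, norm_mul]
        gcongr
      _ = ‖f a - g a‖ + ∑ i ∈ s, ‖f i - g i‖ := by ring

/-- Convergence in distribution depends only on the laws of the variables and of the limit. -/
theorem tendstoInDistribution_of_identDistrib_of_tendsto {Ω Ω₁ : ℕ → Type*} {Ω' Ω₁' : Type*}
    [∀ k, MeasurableSpace (Ω k)] [∀ k, MeasurableSpace (Ω₁ k)] [MeasurableSpace Ω']
    [MeasurableSpace Ω₁'] {P : (k : ℕ) → Measure (Ω k)} [∀ k, IsProbabilityMeasure (P k)]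
    {P₁ : (k : ℕ) → Measure (Ω₁ k)} [∀ k, IsProbabilityMeasure (P₁ k)]
    {P' : Measure Ω'} [IsProbabilityMeasure P'] {P₁' : Measure Ω₁'} [IsProbabilityMeasure P₁']
    {W : (k : ℕ) → Ω k → ℝ} {U : (k : ℕ) → Ω₁ k → ℝ} {Z : Ω' → ℝ} {Z₁ : Ω₁' → ℝ}
    (h : TendstoInDistribution U atTop Z₁ P₁ P₁')
    (hW : ∀ k, IdentDistrib (W k) (U k) (P k) (P₁ k)) (hZ : IdentDistrib Z Z₁ P' P₁') :
    TendstoInDistribution W atTop Z P P' where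
  forall_aemeasurable k := (hW k).aemeasurable_fst
  aemeasurable_limit := hZ.aemeasurable_fst
  tendsto := by
    have h1 (k : ℕ) : (⟨(P k).map (W k), Measure.isProbabilityMeasure_map
        (hW k).aemeasurable_fst⟩ : ProbabilityMeasure ℝ) = ⟨(P₁ k).map (U k),
        Measure.isProbabilityMeasure_map (hW k).aemeasurable_snd⟩ := Subtype.ext (hW k).map_eq
    have h2 : (⟨P'.map Z, Measure.isProbabilityMeasure_map hZ.aemeasurable_fst⟩ :
        ProbabilityMeasure ℝ) = ⟨P₁'.map Z₁,
        Measure.isProbabilityMeasure_map hZ.aemeasurable_snd⟩ := Subtype.ext hZ.map_eq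
    simp_rw [h1, h2]
    exact h.tendsto

theorem memLp_weightedSum {Ω : Type*} [MeasurableSpace Ω] {P : Measure Ω}
    {ξ : ℕ → Ω → ℝ} (hmem : ∀ s, MemLp (ξ s) 2 P) (c : ℕ → ℝ) (m : ℕ) :
    MemLp (fun ω ↦ ∑ s ∈ Finset.range m, c s * ξ s ω) 2 P :=
  memLp_finsetSum _ fun s _ ↦ (hmem s).const_mul _

section WeightedSums

variable {Ω : Type*} [MeasurableSpace Ω] {P : Measure Ω} [IsProbabilityMeasure P]
  {ξ : ℕ → Ω → ℝ}

/-- A central limit theorem for weighted sums of i.i.d. standardized variables: if the squared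
weights add up to `1` and the largest weight tends to `0`, the limit is standard normal. The
characteristic functions of `ξ 0` and of the normal law agree to second order at `0`, so those of
the two weighted sums differ by `o(1) * ∑ₛ (cₛ t)² = o(1)`. -/
theorem tendstoInDistribution_weightedSum_gaussianReal (hmem : ∀ s, MemLp (ξ s) 2 P)
    (hmean : ∀ s, ∫ ω, ξ s ω ∂P = 0) (hvar : ∀ s, Var[ξ s; P] = 1) (hind : iIndepFun ξ P)
    (hid : ∀ s, IdentDistrib (ξ s) (ξ 0) P P) {c : ℕ → ℕ → ℝ} {n : ℕ → ℕ} {M : ℕ → ℝ}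
    (hc : ∀ k, ∑ s ∈ Finset.range (n k), c k s ^ 2 = 1) (hcM : ∀ k s, |c k s| ≤ M k)
    (hM : Tendsto M atTop (𝓝 0)) :
    TendstoInDistribution (fun k ω ↦ ∑ s ∈ Finset.range (n k), c k s * ξ s ω) atTop
      (fun x : ℝ ↦ x) (fun _ ↦ P) (gaussianReal 0 1) where
  forall_aemeasurable k := Finset.aemeasurable_fun_sum _ fun s _ ↦
    (hmem s).aemeasurable.const_mul _
  tendsto := by
    refine ProbabilityMeasure.tendsto_iff_tendsto_charFun.2 fun t ↦ ?_
    simp only [ProbabilityMeasure.coe_mk, Measure.map_id']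
    set φ : ℝ → ℂ := charFun (P.map (ξ 0)) with hφ
    set γ : ℝ → ℂ := charFun (gaussianReal 0 1) with hγ
    have hchar (k : ℕ) : charFun (P.map fun ω ↦ ∑ s ∈ Finset.range (n k), c k s * ξ s ω) t =
        ∏ s ∈ Finset.range (n k), φ (c k s * t) := by
      have hind' := (hind.comp (fun s x ↦ c k s * x) (by fun_prop)).restrict (Finset.range (n k))
      have h := hind'.charFun_map_fun_finsetSum_eq_prod
        fun s _ ↦ (hmem s).aemeasurable.const_mul (c k s)
      rw [h, Finset.prod_apply]
      refine Finset.prod_congr rfl fun s _ ↦ ?_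
      rw [hφ, ← (hid s).map_eq]
      exact charFun_map_mul_comp (hmem s).aemeasurable _ _
    have hgauss (k : ℕ) : γ t = ∏ s ∈ Finset.range (n k), γ (c k s * t) := by
      simp only [hγ, charFun_gaussianReal]
      rw [← Complex.exp_sum]
      congr 1
      have h : ((∑ s ∈ Finset.range (n k), c k s ^ 2 : ℝ) : ℂ) = 1 := by rw [hc]; simp
      push_cast at h ⊢
      simp only [mul_pow, mul_zero, zero_mul, zero_sub, one_mul]
      rw [Finset.sum_neg_distrib, ← Finset.sum_div, ← Finset.sum_mul, h, one_mul]
    have htaylor : (fun u ↦ φ u - γ u) =o[𝓝 0] fun u ↦ u ^ 2 := by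
      have h1 := taylor_charFun_two (hmem 0).aemeasurable (hmean 0) (by
        have h := hvar 0
        rw [variance_eq_integral (hmem 0).aemeasurable, hmean] at h
        simpa using h)
      have h2 := taylor_charFun_two (P := gaussianReal 0 1) (X := id) aemeasurable_id
        (by simp) (by
          have h := variance_id_gaussianReal (μ := 0) (v := 1)
          rw [variance_eq_integral aemeasurable_id] at h
          simpa using h)
      rw [Measure.map_id] at h2
      refine (h1.sub h2).congr (fun u ↦ ?_) fun u ↦ ?_
      · simp [hφ, hγ]
      · simp
    rw [tendsto_iff_norm_sub_tendsto_zero]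
    refine Metric.tendsto_atTop'.2 fun ε hε ↦ ?_
    set η : ℝ := ε / (2 * (t ^ 2 + 1))
    have hη : 0 < η := by positivity
    obtain ⟨δ, hδ, hball⟩ := Metric.eventually_nhds_iff.1 (htaylor.def hη)
    have hMt : Tendsto (fun k ↦ M k * |t|) atTop (𝓝 0) := by simpa using hM.mul_const |t|
    obtain ⟨k₀, hk₀⟩ := eventually_atTop.1 (hMt.eventually_lt_const hδ)
    refine ⟨k₀, fun k hk ↦ ?_⟩
    rw [Real.dist_0_eq_abs, abs_norm, hchar, hgauss k]
    have : IsProbabilityMeasure (P.map (ξ 0)) :=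
      Measure.isProbabilityMeasure_map (hmem 0).aemeasurable
    calc ‖∏ s ∈ Finset.range (n k), φ (c k s * t) - ∏ s ∈ Finset.range (n k), γ (c k s * t)‖
        ≤ ∑ s ∈ Finset.range (n k), ‖φ (c k s * t) - γ (c k s * t)‖ :=
          norm_prod_sub_prod_le_sum _ _ _ (fun _ _ ↦ norm_charFun_le_one _)
            (fun _ _ ↦ norm_charFun_le_one _)
      _ ≤ ∑ s ∈ Finset.range (n k), η * t ^ 2 * c k s ^ 2 := by
          refine Finset.sum_le_sum fun s _ ↦ ?_
          have hdist : dist (c k s * t) 0 < δ := by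
            rw [Real.dist_0_eq_abs, abs_mul]
            exact (mul_le_mul_of_nonneg_right (hcM k s) (abs_nonneg t)).trans_lt (hk₀ k hk.le)
          refine (hball hdist).trans_eq ?_
          rw [Real.norm_of_nonneg (sq_nonneg _)]
          ring
      _ = η * t ^ 2 := by rw [← Finset.mul_sum, hc, mul_one]
      _ < ε := by
          simp only [η]
          rw [div_mul_eq_mul_div, div_lt_iff₀ (by positivity)]
          nlinarith [sq_nonneg t]

theorem eLpNorm_weightedSum (hmem : ∀ s, MemLp (ξ s) 2 P)
    (hmean : ∀ s, ∫ ω, ξ s ω ∂P = 0) (hvar : ∀ s, Var[ξ s; P] = 1) (hind : iIndepFun ξ P)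
    (c : ℕ → ℝ) (m : ℕ) :
    eLpNorm (fun ω ↦ ∑ s ∈ Finset.range m, c s * ξ s ω) 2 P =
      ENNReal.ofReal √(∑ s ∈ Finset.range m, c s ^ 2) := by
  have hS := memLp_weightedSum hmem c m
  have hv : ∫ ω, (∑ s ∈ Finset.range m, c s * ξ s ω) ^ 2 ∂P = ∑ s ∈ Finset.range m, c s ^ 2 := by
    have h0 : ∫ ω, ∑ s ∈ Finset.range m, c s * ξ s ω ∂P = 0 := by
      rw [integral_finsetSum _ fun s _ ↦ ((hmem s).integrable (by norm_num)).const_mul _]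
      simp [integral_const_mul, hmean]
    have h1 : Var[fun ω ↦ ∑ s ∈ Finset.range m, c s * ξ s ω; P] =
        ∑ s ∈ Finset.range m, c s ^ 2 := by
      have hsum : (fun ω ↦ ∑ s ∈ Finset.range m, c s * ξ s ω) =
          ∑ s ∈ Finset.range m, fun ω ↦ c s * ξ s ω := by
        ext ω
        simp
      rw [hsum, IndepFun.variance_sum fun s _ ↦ (hmem s).const_mul _]
      · simp [variance_const_mul, hvar]
      · intro s _ s' _ hss
        exact (hind.indepFun hss).comp (φ := fun x ↦ c s * x) (ψ := fun x ↦ c s' * x)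
          (by fun_prop) (by fun_prop)
    rw [← h1, variance_eq_integral hS.aemeasurable, h0]
    simp
  rw [hS.eLpNorm_eq_integral_rpow_norm two_ne_zero ENNReal.ofNat_ne_top, Real.sqrt_eq_rpow, ← hv]
  norm_num

/-- A series of independent standardized variables with square-summable weights converges almost
surely: its partial sums form an `L²`-bounded martingale. -/
theorem exists_ae_tendsto_weightedSum_of_measurable (hξ : ∀ s, Measurable (ξ s))
    (hmem : ∀ s, MemLp (ξ s) 2 P) (hmean : ∀ s, ∫ ω, ξ s ω ∂P = 0)
    (hvar : ∀ s, Var[ξ s; P] = 1) (hind : iIndepFun ξ P) {b : ℕ → ℝ}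
    (hb : Summable fun s ↦ b s ^ 2) :
    ∃ Z : Ω → ℝ, AEMeasurable Z P ∧ ∀ᵐ ω ∂P,
      Tendsto (fun m ↦ ∑ s ∈ Finset.range m, b s * ξ s ω) atTop (𝓝 (Z ω)) := by
  have hsm (s : ℕ) : StronglyMeasurable (ξ s) := (hξ s).stronglyMeasurable
  set ℱ := Filtration.natural ξ hsm with hℱ
  -- The sums are shifted by one so that the `m`-th one involves exactly `ξ 0, …, ξ m`.
  set S : ℕ → Ω → ℝ := fun m ω ↦ ∑ s ∈ Finset.range (m + 1), b s * ξ s ω with hS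
  have hSint (m : ℕ) : Integrable (S m) P :=
    (memLp_weightedSum hmem b (m + 1)).integrable (by norm_num)
  have hadp : StronglyAdapted ℱ S := fun m ↦ by
    refine Finset.stronglyMeasurable_fun_sum _ fun s hs ↦ StronglyMeasurable.const_mul ?_ (b s)
    exact (Filtration.stronglyAdapted_natural hsm s).mono
      (ℱ.mono (Nat.lt_succ_iff.1 (Finset.mem_range.1 hs)))
  have hmart : Martingale S ℱ P := by
    refine martingale_nat hadp hSint fun m ↦ ?_
    have hsucc : S (m + 1) = S m + b (m + 1) • ξ (m + 1) := by
      ext ω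
      simp only [hS, Pi.add_apply, Pi.smul_apply, smul_eq_mul]
      rw [Finset.sum_range_succ _ (m + 1)]
    have hint : Integrable (ξ (m + 1)) P := (hmem _).integrable (by norm_num)
    rw [hsucc]
    filter_upwards [condExp_add (hSint m) (hint.smul (b (m + 1))) (ℱ m),
      condExp_smul (μ := P) (b (m + 1)) (ξ (m + 1)) (ℱ m),
      hind.condExp_natural_ae_eq_of_lt hsm (Nat.lt_succ_self m)] with ω h1 h2 h3
    rw [h1, Pi.add_apply, h2, Pi.smul_apply, h3, hmean,
      condExp_of_stronglyMeasurable (ℱ.le m) (hadp m) (hSint m)]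
    simp
  have hbdd (m : ℕ) : eLpNorm (S m) 1 P ≤ (√(∑' s, b s ^ 2)).toNNReal := by
    refine (eLpNorm_le_eLpNorm_of_exponent_le (q := 2) (by norm_num)
      (hSint m).aestronglyMeasurable).trans ?_
    rw [hS, eLpNorm_weightedSum hmem hmean hvar hind]
    exact ENNReal.ofReal_le_ofReal (Real.sqrt_le_sqrt
      (hb.sum_le_tsum _ fun _ _ ↦ sq_nonneg _))
  obtain ⟨Z, hZ, hlim⟩ := measurable_limit_of_tendsto_metrizable_ae
    (fun m ↦ (hSint m).aemeasurable) (hmart.submartingale.exists_ae_tendsto_of_bdd hbdd)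
  refine ⟨Z, hZ.aemeasurable, ?_⟩
  filter_upwards [hlim] with ω hω
  exact (tendsto_add_atTop_iff_nat 1).1 hω

theorem exists_ae_tendsto_weightedSum (hmem : ∀ s, MemLp (ξ s) 2 P)
    (hmean : ∀ s, ∫ ω, ξ s ω ∂P = 0) (hvar : ∀ s, Var[ξ s; P] = 1) (hind : iIndepFun ξ P)
    {b : ℕ → ℝ} (hb : Summable fun s ↦ b s ^ 2) :
    ∃ Z : Ω → ℝ, AEMeasurable Z P ∧ ∀ᵐ ω ∂P,
      Tendsto (fun m ↦ ∑ s ∈ Finset.range m, b s * ξ s ω) atTop (𝓝 (Z ω)) := by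
  have hae (s : ℕ) := (hmem s).aemeasurable.ae_eq_mk
  obtain ⟨Z, hZ, hlim⟩ := exists_ae_tendsto_weightedSum_of_measurable
    (ξ := fun s ↦ (hmem s).aemeasurable.mk (ξ s)) (fun s ↦ (hmem s).aemeasurable.measurable_mk)
    (fun s ↦ (memLp_congr_ae (hae s)).1 (hmem s))
    (fun s ↦ (integral_congr_ae (hae s)).symm.trans (hmean s))
    (fun s ↦ (variance_congr (hae s)).symm.trans (hvar s)) (hind.congr hae) hb
  refine ⟨Z, hZ, ?_⟩
  filter_upwards [hlim, ae_all_iff.2 hae] with ω hω hω'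
  simpa only [hω'] using hω

/-- Nonnegative unit vectors of `ℓ²` that converge coordinatewise to a unit vector converge to it in
norm. By `(x - y)² ≤ |x² - y²|` for `x, y ≥ 0`, this is Scheffé's lemma for the squares. -/
theorem tendsto_tsum_sq_sub_of_tendsto {c : ℕ → ℕ → ℝ} {b : ℕ → ℝ} (hc0 : ∀ k s, 0 ≤ c k s)
    (hb0 : ∀ s, 0 ≤ b s) (hc : ∀ k, HasSum (fun s ↦ c k s ^ 2) 1)
    (hb : HasSum (fun s ↦ b s ^ 2) 1) (hlim : ∀ s, Tendsto (fun k ↦ c k s) atTop (𝓝 (b s))) :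
    (∀ k, Summable fun s ↦ (c k s - b s) ^ 2) ∧
      Tendsto (fun k ↦ ∑' s, (c k s - b s) ^ 2) atTop (𝓝 0) := by
  have hle (k s : ℕ) : (c k s - b s) ^ 2 ≤
      (c k s ^ 2 - b s ^ 2) + 2 * max (b s ^ 2 - c k s ^ 2) 0 := by
    have h1 := hc0 k s
    have h2 := hb0 s
    rcases le_total (b s) (c k s) with h | h
    · have := le_max_right (b s ^ 2 - c k s ^ 2) 0
      nlinarith
    · have := le_max_left (b s ^ 2 - c k s ^ 2) 0
      nlinarith
  have hpos (k s : ℕ) : ‖max (b s ^ 2 - c k s ^ 2) 0‖ ≤ b s ^ 2 := by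
    rw [Real.norm_of_nonneg (le_max_right _ _)]
    exact max_le (sub_le_self _ (sq_nonneg _)) (sq_nonneg _)
  have hpsum (k : ℕ) : Summable fun s ↦ max (b s ^ 2 - c k s ^ 2) 0 :=
    .of_norm_bounded hb.summable (hpos k)
  have hsum (k : ℕ) : HasSum (fun s ↦ (c k s ^ 2 - b s ^ 2) + 2 * max (b s ^ 2 - c k s ^ 2) 0)
      ((1 - 1) + 2 * ∑' s, max (b s ^ 2 - c k s ^ 2) 0) :=
    ((hc k).sub hb).add ((hpsum k).hasSum.mul_left 2)
  have hS (k : ℕ) : Summable fun s ↦ (c k s - b s) ^ 2 :=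
    .of_nonneg_of_le (fun s ↦ sq_nonneg _) (hle k) (hsum k).summable
  refine ⟨hS, ?_⟩
  have hdom : Tendsto (fun k ↦ ∑' s, max (b s ^ 2 - c k s ^ 2) 0) atTop (𝓝 (∑' _ : ℕ, (0 : ℝ))) :=
    tendsto_tsum_of_dominated_convergence hb.summable
      (fun s ↦ by
        have h := (((hlim s).pow 2).const_sub (b s ^ 2)).max (tendsto_const_nhds (x := (0 : ℝ)))
        simpa using h)
      (.of_forall hpos)
  refine squeeze_zero (fun k ↦ tsum_nonneg fun s ↦ sq_nonneg _)
    (fun k ↦ hasSum_le (hle k) (hS k).hasSum (hsum k)) ?_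
  simpa using hdom.const_mul 2

/-- If the weights are nonnegative unit vectors of `ℓ²` converging coordinatewise to a unit vector
`b`, the weighted sums converge in distribution to the sum of the series with weights `b`. All sums
live on one probability space, where the convergence holds in `L²`. -/
theorem tendstoInDistribution_weightedSum (hmem : ∀ s, MemLp (ξ s) 2 P)
    (hmean : ∀ s, ∫ ω, ξ s ω ∂P = 0) (hvar : ∀ s, Var[ξ s; P] = 1) (hind : iIndepFun ξ P)
    {c : ℕ → ℕ → ℝ} {n : ℕ → ℕ} {b : ℕ → ℝ} (hc0 : ∀ k s, 0 ≤ c k s) (hb0 : ∀ s, 0 ≤ b s)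
    (hcn : ∀ k s, n k ≤ s → c k s = 0) (hc : ∀ k, ∑ s ∈ Finset.range (n k), c k s ^ 2 = 1)
    (hb : HasSum (fun s ↦ b s ^ 2) 1) (hlim : ∀ s, Tendsto (fun k ↦ c k s) atTop (𝓝 (b s)))
    {Z : Ω → ℝ} (hZm : AEMeasurable Z P) (hZ : ∀ᵐ ω ∂P,
      Tendsto (fun m ↦ ∑ s ∈ Finset.range m, b s * ξ s ω) atTop (𝓝 (Z ω))) :
    TendstoInDistribution (fun k ω ↦ ∑ s ∈ Finset.range (n k), c k s * ξ s ω) atTop Z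
      (fun _ ↦ P) P := by
  have hcs (k : ℕ) : HasSum (fun s ↦ c k s ^ 2) 1 := by
    rw [← hc k]
    refine hasSum_sum_of_ne_finset_zero fun s hs ↦ ?_
    rw [hcn k s (by simpa using hs), sq, mul_zero]
  obtain ⟨hS, hto⟩ := tendsto_tsum_sq_sub_of_tendsto hc0 hb0 hcs hb hlim
  have hbound (k : ℕ) : eLpNorm ((fun ω ↦ ∑ s ∈ Finset.range (n k), c k s * ξ s ω) - Z) 2 P ≤
      ENNReal.ofReal √(∑' s, (c k s - b s) ^ 2) := by
    -- Fatou's lemma, applied to the partial sums of the series with weights `c k - b`.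
    refine (Lp.eLpNorm_lim_le_liminf_eLpNorm
      (f := fun m ω ↦ ∑ s ∈ Finset.range m, (c k s - b s) * ξ s ω)
      (fun m ↦ (memLp_weightedSum hmem _ m).aestronglyMeasurable) _ ?_).trans ?_
    · filter_upwards [hZ] with ω hω
      have hev : ∀ᶠ m in atTop, ∑ s ∈ Finset.range (n k), c k s * ξ s ω -
          ∑ s ∈ Finset.range m, b s * ξ s ω =
          ∑ s ∈ Finset.range m, (c k s - b s) * ξ s ω := by
        filter_upwards [eventually_ge_atTop (n k)] with m hm
        have hext : ∑ s ∈ Finset.range (n k), c k s * ξ s ω =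
            ∑ s ∈ Finset.range m, c k s * ξ s ω := by
          refine Finset.sum_subset (Finset.range_mono hm) fun s _ hs ↦ ?_
          rw [hcn k s (by simpa using hs), zero_mul]
        rw [hext, ← Finset.sum_sub_distrib]
        exact Finset.sum_congr rfl fun s _ ↦ (sub_mul _ _ _).symm
      exact (tendsto_const_nhds.sub hω).congr' hev
    · refine liminf_le_of_frequently_le' (Frequently.of_forall fun m ↦ ?_)
      rw [eLpNorm_weightedSum hmem hmean hvar hind]
      exact ENNReal.ofReal_le_ofReal (Real.sqrt_le_sqrt
        ((hS k).sum_le_tsum _ fun _ _ ↦ sq_nonneg _))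
  have hUm (k : ℕ) := memLp_weightedSum hmem (c k) (n k)
  refine TendstoInMeasure.tendstoInDistribution_of_aemeasurable ?_
    (fun k ↦ (hUm k).aemeasurable) hZm
  refine tendstoInMeasure_of_tendsto_eLpNorm two_ne_zero
    (fun k ↦ (hUm k).aestronglyMeasurable) hZm.aestronglyMeasurable ?_
  refine tendsto_of_tendsto_of_tendsto_of_le_of_le tendsto_const_nhds ?_
    (fun _ ↦ zero_le) hbound
  have h := ENNReal.tendsto_ofReal ((Real.continuous_sqrt.tendsto 0).comp hto)
  simpa using h

end WeightedSums

/-! ### The three limit regimes -/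

section ChiSquare

variable {Ω : Type*} [MeasurableSpace Ω] {P : Measure Ω} {C : Ω → ℝ}

theorem memLp_standardized_chiSq (hC : HasLaw C chiSqOne P) :
    MemLp (fun ω ↦ (C ω - 1) / √2) 2 P := by
  have := hC.isProbabilityMeasure
  have h : MemLp C 2 P := (hC.identDistrib HasLaw.id).symm.memLp_snd memLp_two_id_chiSqOne
  simp only [div_eq_inv_mul]
  exact (h.sub (memLp_const 1)).const_mul (√2)⁻¹

theorem integral_standardized_chiSq (hC : HasLaw C chiSqOne P) :
    ∫ ω, (C ω - 1) / √2 ∂P = 0 := by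
  have := hC.isProbabilityMeasure
  have h : MemLp C 2 P := (hC.identDistrib HasLaw.id).symm.memLp_snd memLp_two_id_chiSqOne
  rw [integral_div, integral_sub (h.integrable (by norm_num)) (integrable_const 1), hC.integral_eq,
    integral_id_chiSqOne]
  simp

theorem variance_standardized_chiSq (hC : HasLaw C chiSqOne P) :
    Var[fun ω ↦ (C ω - 1) / √2; P] = 1 := by
  have := hC.isProbabilityMeasure
  simp only [div_eq_inv_mul]
  rw [variance_const_mul, variance_sub_const hC.aemeasurable.aestronglyMeasurable, hC.variance_eq,
    variance_id_chiSqOne, inv_pow, Real.sq_sqrt (by norm_num)]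
  norm_num

end ChiSquare

/-- If the normalized eigenvalues converge coordinatewise to a unit vector `b` of `ℓ²`, the
standardized quadratic forms converge in distribution to the sum of the almost surely convergent
series with weights `b`. -/
theorem exists_tendstoInDistribution_W_of_tendsto_β
    (D : ℕ → SplitPlotDesign) (hT : ∀ k, (D k).T ≠ 0) (hnull : ∀ k, (D k).NullHypothesis)
    {Ω : ℕ → Type*} [∀ k, MeasurableSpace (Ω k)]
    (P : (k : ℕ) → Measure (Ω k)) [∀ k, IsProbabilityMeasure (P k)]
    (X : (k : ℕ) → (i : Fin (D k).a) → Fin ((D k).n i) → Ω k → EuclideanSpace ℝ (Fin (D k).d))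
    (hX : ∀ k, (D k).IsGaussianSample (P k) (X k))
    {b : ℕ → ℝ} (hb0 : ∀ s, 0 ≤ b s) (hb : HasSum (fun s ↦ b s ^ 2) 1)
    (hlim : ∀ s, Tendsto (fun k ↦ (D k).β s) atTop (𝓝 (b s)))
    {Ω' : Type*} [MeasurableSpace Ω'] (P' : Measure Ω') [IsProbabilityMeasure P']
    {C : ℕ → Ω' → ℝ} (hC : ∀ s, HasLaw (C s) chiSqOne P') (hind : iIndepFun C P') :
    ∃ Z : Ω' → ℝ,
      (∀ᵐ ω ∂P', Tendsto
        (fun m ↦ ∑ s ∈ Finset.range m, b s * ((C s ω - 1) / √2)) atTop (𝓝 (Z ω))) ∧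
      TendstoInDistribution (fun k ↦ (D k).W (P k) (X k)) atTop Z P P' := by
  have hmem (s : ℕ) := memLp_standardized_chiSq (hC s)
  have hmean (s : ℕ) := integral_standardized_chiSq (hC s)
  have hvar (s : ℕ) := variance_standardized_chiSq (hC s)
  have hind' : iIndepFun (fun s ω ↦ (C s ω - 1) / √2) P' :=
    hind.comp (fun _ x ↦ (x - 1) / √2) (by fun_prop)
  obtain ⟨Z, hZm, hZ⟩ := exists_ae_tendsto_weightedSum hmem hmean hvar hind' hb.summable
  refine ⟨Z, hZ, tendstoInDistribution_of_identDistrib_of_tendsto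
    (tendstoInDistribution_weightedSum hmem hmean hvar hind'
      (fun k s ↦ SplitPlotDesign.β_nonneg (D := D k) s) hb0
      (fun k s hs ↦ SplitPlotDesign.β_eq_zero_of_card_le hs)
      (fun k ↦ SplitPlotDesign.sum_sq_β (hT k)) hb hlim hZm hZ)
    (fun k ↦ (hX k).identDistrib_W (hnull k) hC hind) (IdentDistrib.refl hZm)⟩

/-- If the largest normalized eigenvalue tends to `1`, all others tend to `0`, since their squares
add up to `1`. -/
theorem SplitPlotDesign.tendsto_β_of_tendsto_β_zero_one {D : ℕ → SplitPlotDesign}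
    (hT : ∀ k, (D k).T ≠ 0) (h : Tendsto (fun k ↦ (D k).β 0) atTop (𝓝 1)) (s : ℕ) :
    Tendsto (fun k ↦ (D k).β s) atTop (𝓝 (if s = 0 then 1 else 0)) := by
  by_cases hs : s = 0
  · simpa [hs] using h
  simp only [hs, if_false]
  have hle (k : ℕ) : (D k).β s ^ 2 ≤ 1 - (D k).β 0 ^ 2 := by
    have hsum : HasSum (fun s ↦ (D k).β s ^ 2) 1 := by
      rw [← sum_sq_β (hT k)]
      refine hasSum_sum_of_ne_finset_zero fun s hs ↦ ?_
      rw [β_eq_zero_of_card_le (by simpa using hs), sq, mul_zero]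
    have h2 := sum_le_hasSum {s, 0} (fun _ _ ↦ sq_nonneg _) hsum
    rw [Finset.sum_pair hs] at h2
    linarith
  have hsq : Tendsto (fun k ↦ (D k).β s ^ 2) atTop (𝓝 0) :=
    squeeze_zero (fun k ↦ sq_nonneg _) hle (by simpa using (h.pow 2).const_sub 1)
  have hsqrt := (Real.continuous_sqrt.tendsto 0).comp hsq
  simpa [Function.comp_def, Real.sqrt_sq (β_nonneg s)] using hsqrt

theorem mainTheorem1
    (D : ℕ → SplitPlotDesign)
    (hframe : AsymptoticFramework D)
    (hT : ∀ k, (D k).T ≠ 0)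
    (hnull : ∀ k, (D k).NullHypothesis)
    {Ω : ℕ → Type*} [∀ k, MeasurableSpace (Ω k)]
    (P : (k : ℕ) → Measure (Ω k)) [∀ k, IsProbabilityMeasure (P k)]
    (X : (k : ℕ) → (i : Fin (D k).a) → Fin ((D k).n i) → Ω k → EuclideanSpace ℝ (Fin (D k).d))
    (hX : ∀ k, (D k).IsGaussianSample (P k) (X k)) :
    -- (a) standard normal limit
    (Tendsto (fun k => (D k).β 0) atTop (𝓝 0) →
      TendstoInDistribution (fun k => (D k).W (P k) (X k)) atTop
        (fun x : ℝ => x) P (gaussianReal 0 1)) ∧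
    -- (b) standardized chi-square limit
    (Tendsto (fun k => (D k).β 0) atTop (𝓝 1) →
      TendstoInDistribution (fun k => (D k).W (P k) (X k)) atTop
        (fun x : ℝ => (x - 1) / √2) P chiSqOne) ∧
    -- (c) weighted sum of independent standardized chi-square variables
    (∀ b : ℕ → ℝ, Antitone b → (∀ s, b s ∈ Set.Icc (0 : ℝ) 1) →
      HasSum (fun s => b s ^ 2) 1 →
      (∀ s, Tendsto (fun k => (D k).β s) atTop (𝓝 (b s))) →
      ∀ {Ω' : Type*} [MeasurableSpace Ω'] (P' : Measure Ω') [IsProbabilityMeasure P']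
        (C : ℕ → Ω' → ℝ), (∀ s, HasLaw (C s) chiSqOne P') → iIndepFun C P' →
        ∃ Z : Ω' → ℝ,
          (∀ᵐ ω ∂P', Tendsto
            (fun m => ∑ s ∈ Finset.range m, b s * ((C s ω - 1) / √2)) atTop (𝓝 (Z ω))) ∧
          TendstoInDistribution (fun k => (D k).W (P k) (X k)) atTop Z P P') := by
  -- By equality of laws, the sums may be formed on any space that carries i.i.d. `χ²₁` variables.
  obtain ⟨Ω₀, _, P₀, C₀, -, hC₀, hind₀, _⟩ := exists_iid ℕ chiSqOne
  refine ⟨fun hβ ↦ ?_, fun hβ ↦ ?_, ?_⟩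
  · have hind' : iIndepFun (fun s ω ↦ (C₀ s ω - 1) / √2) P₀ :=
      hind₀.comp (fun _ x ↦ (x - 1) / √2) (by fun_prop)
    refine tendstoInDistribution_of_identDistrib_of_tendsto
      (tendstoInDistribution_weightedSum_gaussianReal
        (fun s ↦ memLp_standardized_chiSq (hC₀ s)) (fun s ↦ integral_standardized_chiSq (hC₀ s))
        (fun s ↦ variance_standardized_chiSq (hC₀ s)) hind'
        (fun s ↦ ((hC₀ s).identDistrib (hC₀ 0)).comp (u := fun x ↦ (x - 1) / √2) (by fun_prop))
        (fun k ↦ SplitPlotDesign.sum_sq_β (hT k)) (fun k s ↦ ?_) hβ)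
      (fun k ↦ (hX k).identDistrib_W (hnull k) hC₀ hind₀) (IdentDistrib.refl aemeasurable_id)
    rw [abs_of_nonneg (SplitPlotDesign.β_nonneg s)]
    exact SplitPlotDesign.β_le_β_zero s
  · -- The limit weights are `(1, 0, 0, …)`, so the limit series reduces to its first term.
    set b : ℕ → ℝ := fun s ↦ if s = 0 then 1 else 0 with hb
    have hbsum : HasSum (fun s ↦ b s ^ 2) 1 := by
      have h := hasSum_ite_eq (0 : ℕ) (1 : ℝ)
      simpa [hb, ite_pow] using h
    obtain ⟨Z, hZ, hconv⟩ := exists_tendstoInDistribution_W_of_tendsto_β D hT hnull P X hX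
      (b := b) (fun s ↦ by simp only [hb]; split_ifs <;> norm_num) hbsum
      (SplitPlotDesign.tendsto_β_of_tendsto_β_zero_one hT hβ) P₀ hC₀ hind₀
    have hZeq : (fun ω ↦ (C₀ 0 ω - 1) / √2) =ᵐ[P₀] Z := by
      filter_upwards [hZ] with ω hω
      refine tendsto_nhds_unique (tendsto_const_nhds.congr' ?_) hω
      filter_upwards [eventually_ge_atTop 1] with m hm
      rw [Finset.sum_eq_single_of_mem 0 (Finset.mem_range.2 hm) fun s _ hs ↦ by simp [hb, hs]]
      simp [hb]
    refine tendstoInDistribution_of_identDistrib_of_tendsto hconv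
      (fun k ↦ IdentDistrib.refl (hconv.forall_aemeasurable k)) (IdentDistrib.trans
        (ν := P₀) (g := fun ω ↦ (C₀ 0 ω - 1) / √2) ?_ ?_)
    · exact (HasLaw.id.identDistrib (hC₀ 0)).comp (u := fun x ↦ (x - 1) / √2) (by fun_prop)
    · exact IdentDistrib.of_ae_eq
        (memLp_standardized_chiSq (hC₀ 0)).aemeasurable hZeq
  · intro b _ hb01 hb hlim Ω' _ P' _ C hC hind
    exact exists_tendstoInDistribution_W_of_tendsto_β D hT hnull P X hX
      (fun s ↦ (hb01 s).1) hb hlim P' hC hind
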